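/- Let $k\ge 1$ be an integer, let $\Omega=\{1,\dots,k\}^{\mathbb N}$ be the full one-sided shift space with the metric $d(x,y)=2^{-\min\{n:\,x_n\neq y_n\}}$ (equivalently, with the product topology), and let $\sigma:\Omega\to\Omega$, $\sigma(x_0x_1x_2\ldots)=x_1x_2x_3\ldots$, be the shift. Let $A:\Omega\to\mathbb R$ be a continuous function (in particular, $A$ may be any Lipschitz or Hölder continuous potential), and put $$m(A)=\max\Big\{\int A\,d\nu:\ \nu\text{ a }\sigma\text{-invariant Borel probability measure on }\Omega\Big\}.$$ A $\sigma$-invariant Borel probability measure $\mu$ is called $A$-maximizing if $\int A\,d\mu=m(A)$. A continuous function $u:\Omega\to\mathbb R$ is called a calibrated subaction for $A$ if for every $x\in\Omega$ $$u(x)=\max_{\sigma(y)=x}\big[A(y)+u(y)-m(A)\big].$$ Theorem. If there is a unique $A$-maximizing measure, then all calibrated subactions for $A$ are equal up to an additive constant: for any two calibrated subactions $u,v$ for $A$ there is a constant $c\in\mathbb R$ such that $u(x)=v(x)+c$ for all $x\in\Omega$. -/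

import Mathlib

open MeasureTheory

/-- The full one-sided shift space over an alphabet with `k` letters: all infinite words
`x = x₀ x₁ x₂ …`. It carries the product topology, which is the topology of the metric
`d(x, y) = 2 ^ (- min {n | x n ≠ y n})`, and the corresponding Borel σ-algebra. -/
abbrev ShiftSpace (k : ℕ) : Type := ℕ → Fin k

/-- The shift `σ (x₀ x₁ x₂ …) = x₁ x₂ x₃ …`. -/
def shift {k : ℕ} (x : ShiftSpace k) : ShiftSpace k := fun n => x (n + 1)

/-- `μ` is a shift-invariant Borel probability measure. -/
def IsInvariantProbability {k : ℕ} (μ : Measure (ShiftSpace k)) : Prop :=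
  IsProbabilityMeasure μ ∧ MeasurePreserving (shift (k := k)) μ μ

/-- `m(A)`, the maximal integral of `A` over the invariant probability measures. For continuous
`A` and a nonempty alphabet the set is nonempty and bounded, and the supremum is attained. -/
noncomputable def maxIntegral {k : ℕ} (A : ShiftSpace k → ℝ) : ℝ :=
  sSup {r : ℝ | ∃ ν : Measure (ShiftSpace k), IsInvariantProbability ν ∧ r = ∫ x, A x ∂ν}

/-- `μ` is an `A`-maximizing measure: an invariant probability measure whose integral of `A` is
the largest among all invariant probability measures. -/
def IsMaximizingMeasure {k : ℕ} (A : ShiftSpace k → ℝ) (μ : Measure (ShiftSpace k)) : Prop :=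
  IsInvariantProbability μ ∧
    ∀ ν : Measure (ShiftSpace k), IsInvariantProbability ν → ∫ x, A x ∂ν ≤ ∫ x, A x ∂μ

/-- `u` is a calibrated subaction for `A`: it is continuous, and for every `x`
`u x = max {A y + u y - m(A) | σ y = x}` (the maximum being attained). -/
def IsCalibratedSubaction {k : ℕ} (A u : ShiftSpace k → ℝ) : Prop :=
  Continuous u ∧
    ∀ x : ShiftSpace k,
      IsGreatest ((fun y => A y + u y - maxIntegral A) '' {y | shift y = x}) (u x)

open Filter Topology

/-! From `x`, follow a backward orbit realizing the maxima for `u`. Along it `u - v` is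
nondecreasing, since `u` satisfies the calibration equality and `v` at least the inequality. A limit
`ν` of the empirical measures is invariant, and it is maximizing because `A - m(A)` telescopes along
the orbit; hence `u x - v x ≤ ∫ (u - v) ∂ν` (`exists_isMaximizingMeasure_sub_le`). By uniqueness `ν
= μ` for every `x`, so `u - v ≤ c := ∫ (u - v) ∂μ` everywhere; exchanging `u` and `v` gives `v - u ≤
-c`. -/

theorem continuous_shift {k : ℕ} : Continuous (shift (k := k)) :=
  continuous_pi fun n => continuous_apply (n + 1)

theorem integrable_of_continuous {k : ℕ} {f : ShiftSpace k → ℝ} (hf : Continuous f)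
    (μ : Measure (ShiftSpace k)) [IsFiniteMeasure μ] : Integrable f μ :=
  hf.integrable_of_hasCompactSupport (HasCompactSupport.of_compactSpace f)

/-- Integrals of continuous functions are unchanged by the shift under an invariant measure. -/
theorem IsInvariantProbability.integral_comp_shift {k : ℕ} {μ : Measure (ShiftSpace k)}
    (hμ : IsInvariantProbability μ) {f : ShiftSpace k → ℝ} (hf : Continuous f) :
    ∫ x, f (shift x) ∂μ = ∫ x, f x ∂μ := by
  conv_rhs => rw [← hμ.2.map_eq]
  exact (integral_map hμ.2.measurable.aemeasurable hf.aestronglyMeasurable).symm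

theorem isInvariantProbability_of_integral_comp_shift {k : ℕ} {μ : Measure (ShiftSpace k)}
    [IsProbabilityMeasure μ]
    (h : ∀ f : ShiftSpace k → ℝ, Continuous f → ∫ x, f (shift x) ∂μ = ∫ x, f x ∂μ) :
    IsInvariantProbability μ := by
  have hm : Measurable (shift (k := k)) := continuous_shift.measurable
  refine ⟨inferInstance, hm, ?_⟩
  have : IsProbabilityMeasure (μ.map (shift (k := k))) :=
    Measure.isProbabilityMeasure_map hm.aemeasurable
  refine ext_of_forall_integral_eq_of_IsFiniteMeasure fun f => ?_
  rw [integral_map hm.aemeasurable f.continuous.aestronglyMeasurable, h f f.continuous]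

/-- The uniform probability measure on the first `n + 1` points of a sequence. -/
noncomputable def empiricalMeasure {X : Type*} [MeasurableSpace X] (y : ℕ → X) (n : ℕ) :
    Measure X :=
  ((n : ENNReal) + 1)⁻¹ • ∑ i ∈ Finset.range (n + 1), Measure.dirac (y i)

instance {X : Type*} [MeasurableSpace X] (y : ℕ → X) (n : ℕ) :
    IsProbabilityMeasure (empiricalMeasure y n) := by
  constructor
  simp only [empiricalMeasure, Measure.smul_apply, Measure.finsetSum_apply, measure_univ,
    Finset.sum_const, Finset.card_range, nsmul_eq_mul, smul_eq_mul, mul_one]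
  push_cast
  exact ENNReal.inv_mul_cancel (by simp) (by finiteness)

theorem integral_empiricalMeasure {k : ℕ} (y : ℕ → ShiftSpace k) (n : ℕ)
    {f : ShiftSpace k → ℝ} (hf : Continuous f) :
    ∫ x, f x ∂(empiricalMeasure y n) = (∑ i ∈ Finset.range (n + 1), f (y i)) / (n + 1) := by
  rw [empiricalMeasure, integral_smul_measure,
    integral_finsetSum_measure fun i _ => integrable_of_continuous hf _]
  simp only [integral_dirac]
  rw [ENNReal.toReal_inv, ENNReal.toReal_add (by finiteness) (by simp), smul_eq_mul,
    div_eq_inv_mul]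
  simp

/-- A sequence of points has a limit distribution along the hyperfilter. -/
theorem exists_tendsto_hyperfilter_average {k : ℕ} (y : ℕ → ShiftSpace k) :
    ∃ ν : Measure (ShiftSpace k), IsProbabilityMeasure ν ∧
      ∀ f : ShiftSpace k → ℝ, Continuous f →
        Tendsto (fun n : ℕ => (∑ i ∈ Finset.range (n + 1), f (y i)) / (n + 1))
          (hyperfilter ℕ : Filter ℕ) (𝓝 (∫ x, f x ∂ν)) := by
  let P : ℕ → ProbabilityMeasure (ShiftSpace k) := fun n => ⟨empiricalMeasure y n, inferInstance⟩
  -- Weak compactness of the probability measures; one ultrafilter serves all `f` at once, with no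
  -- subsequence to extract.
  obtain ⟨ν, -, hν⟩ := isCompact_univ.ultrafilter_le_nhds ((hyperfilter ℕ).map P) (by simp)
  refine ⟨ν, inferInstance, fun f hf => ?_⟩
  have h := ProbabilityMeasure.tendsto_iff_forall_integral_tendsto.1
    (show Tendsto P (hyperfilter ℕ : Filter ℕ) (𝓝 ν) from hν)
    (BoundedContinuousFunction.mkOfCompact ⟨f, hf⟩)
  refine h.congr fun n => ?_
  exact integral_empiricalMeasure y n hf

/-- Averages of the increments of a bounded sequence tend to zero. -/
theorem tendsto_average_sub_succ {b : ℕ → ℝ} {C : ℝ} (hb : ∀ n, |b n| ≤ C) :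
    Tendsto (fun n : ℕ => (∑ i ∈ Finset.range (n + 1), (b i - b (i + 1))) / ((n : ℝ) + 1))
      (hyperfilter ℕ : Filter ℕ) (𝓝 0) := by
  refine Tendsto.mono_left ?_ Nat.hyperfilter_le_atTop
  refine squeeze_zero_norm (a := fun n : ℕ => (2 * C) * (1 / ((n : ℝ) + 1))) (fun n => ?_)
    (by simpa using tendsto_one_div_add_atTop_nhds_zero_nat.const_mul (2 * C))
  have hn : (0 : ℝ) < n + 1 := by positivity
  rw [Finset.sum_range_sub', Real.norm_eq_abs, abs_div, abs_of_pos hn, mul_one_div]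
  gcongr
  have := abs_sub (b 0) (b (n + 1))
  linarith [hb 0, hb (n + 1)]

theorem exists_bound {k : ℕ} {f : ShiftSpace k → ℝ} (hf : Continuous f) :
    ∃ C, ∀ x, |f x| ≤ C := by
  obtain ⟨C, hC⟩ := isCompact_univ.exists_bound_of_continuousOn hf.continuousOn
  exact ⟨C, fun x => hC x trivial⟩

/-- The limit distribution of a backward orbit is invariant. -/
theorem exists_isInvariantProbability_tendsto {k : ℕ} {y : ℕ → ShiftSpace k}
    (hy : ∀ n, shift (y (n + 1)) = y n) :
    ∃ ν : Measure (ShiftSpace k), IsInvariantProbability ν ∧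
      ∀ f : ShiftSpace k → ℝ, Continuous f →
        Tendsto (fun n : ℕ => (∑ i ∈ Finset.range (n + 1), f (y (i + 1))) / (n + 1))
          (hyperfilter ℕ : Filter ℕ) (𝓝 (∫ x, f x ∂ν)) := by
  obtain ⟨ν, hν, h⟩ := exists_tendsto_hyperfilter_average fun n => y (n + 1)
  refine ⟨ν, isInvariantProbability_of_integral_comp_shift fun f hf => ?_, h⟩
  obtain ⟨C, hC⟩ := exists_bound hf
  -- As `shift (y (i + 1)) = y i`, the averages of `f ∘ shift - f` telescope.
  have h0 := tendsto_average_sub_succ fun n => hC (y n)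
  have h1 := (h _ (hf.comp continuous_shift)).sub (h f hf)
  refine sub_eq_zero.1 (tendsto_nhds_unique h1 (h0.congr fun n => ?_))
  simp [hy, Finset.sum_sub_distrib, sub_div]

namespace IsCalibratedSubaction

variable {k : ℕ} {A u v : ShiftSpace k → ℝ}

theorem le (hu : IsCalibratedSubaction A u) (y : ShiftSpace k) :
    A y + u y - maxIntegral A ≤ u (shift y) :=
  (hu.2 (shift y)).2 ⟨y, rfl, rfl⟩

/-- Every point is the endpoint of a backward orbit realizing the maxima. -/
theorem exists_backward_orbit (hu : IsCalibratedSubaction A u) (x : ShiftSpace k) :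
    ∃ y : ℕ → ShiftSpace k, y 0 = x ∧ (∀ n, shift (y (n + 1)) = y n) ∧
      ∀ n, A (y (n + 1)) + u (y (n + 1)) - maxIntegral A = u (y n) := by
  choose g hg hgu using fun x => (hu.2 x).1
  refine ⟨fun n => g^[n] x, rfl, fun n => ?_, fun n => ?_⟩
  · simpa only [Function.iterate_succ_apply', Set.mem_ofPred_eq] using hg (g^[n] x)
  · simpa only [Function.iterate_succ_apply'] using hgu _

/-- Integrate `A + u - m(A) ≤ u ∘ shift`: invariance cancels `u`. Boundedness of the set under the
`sSup` is not needed. -/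
theorem integral_le_maxIntegral (hA : Continuous A) (hu : IsCalibratedSubaction A u)
    {ν : Measure (ShiftSpace k)} (hν : IsInvariantProbability ν) :
    ∫ x, A x ∂ν ≤ maxIntegral A := by
  have := hν.1
  have hAi := integrable_of_continuous hA ν
  have hui := integrable_of_continuous hu.1 ν
  have hus : Integrable (fun x => u (shift x)) ν :=
    integrable_of_continuous (hu.1.comp continuous_shift) ν
  have h : ∫ x, (A x + u x) ∂ν ≤ ∫ x, (u (shift x) + maxIntegral A) ∂ν :=
    integral_mono (hAi.add hui) (hus.add (integrable_const _)) fun x => by linarith [hu.le x]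
  rw [integral_add hAi hui, integral_add hus (integrable_const _),
    hν.integral_comp_shift hu.1] at h
  simp only [integral_const, probReal_univ, one_smul] at h
  linarith

/-- For every point there is a maximizing measure whose integral of `u - v` dominates the value of
`u - v` at that point. -/
theorem exists_isMaximizingMeasure_sub_le (hA : Continuous A) (hu : IsCalibratedSubaction A u)
    (hv : IsCalibratedSubaction A v) (x : ShiftSpace k) :
    ∃ ν : Measure (ShiftSpace k), IsMaximizingMeasure A ν ∧
      u x - v x ≤ ∫ z, (u z - v z) ∂ν := by
  obtain ⟨y, rfl, hy, hyu⟩ := hu.exists_backward_orbit x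
  obtain ⟨ν, hν, h⟩ := exists_isInvariantProbability_tendsto hy
  -- Equality for `u` minus inequality for `v`: `A` and `m(A)` cancel.
  have hmono : Monotone fun n => u (y n) - v (y n) := monotone_nat_of_le_succ fun n => by
    have := hv.le (y (n + 1))
    rw [hy n] at this
    linarith [hyu n]
  have hAν : ∫ z, A z ∂ν = maxIntegral A := by
    obtain ⟨C, hC⟩ := exists_bound hu.1
    have h0 := (tendsto_average_sub_succ fun n => hC (y n)).add_const (maxIntegral A)
    rw [zero_add] at h0
    refine tendsto_nhds_unique (h A hA) (h0.congr fun n => ?_)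
    have hn : (n : ℝ) + 1 ≠ 0 := by positivity
    -- On the orbit, `A` is `m(A)` plus an increment of the bounded sequence `u (y i)`.
    have hs : ∀ i, A (y (i + 1)) = (u (y i) - u (y (i + 1))) + maxIntegral A :=
      fun i => by linarith [hyu i]
    simp only [hs, Finset.sum_add_distrib, Finset.sum_const, Finset.card_range, nsmul_eq_mul]
    push_cast
    field_simp
  refine ⟨ν, ⟨hν, fun ν' hν' => ?_⟩, ?_⟩
  · rw [hAν]
    exact hu.integral_le_maxIntegral hA hν'
  · refine ge_of_tendsto' (h _ (hu.1.sub hv.1)) fun n => ?_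
    rw [le_div_iff₀ (by positivity)]
    have := Finset.card_nsmul_le_sum (Finset.range (n + 1))
      (fun i => u (y (i + 1)) - v (y (i + 1))) (u (y 0) - v (y 0))
      fun i _ => hmono (Nat.zero_le (i + 1))
    simpa [mul_comm] using this

end IsCalibratedSubaction

theorem mainTheorem10 (k : ℕ) (A : ShiftSpace k → ℝ) (hA : Continuous A)
    (hmax : ∃! μ : Measure (ShiftSpace k), IsMaximizingMeasure A μ)
    (u v : ShiftSpace k → ℝ) (hu : IsCalibratedSubaction A u) (hv : IsCalibratedSubaction A v) :
    ∃ c : ℝ, ∀ x : ShiftSpace k, u x = v x + c := by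
  obtain ⟨μ, -, huniq⟩ := hmax
  refine ⟨∫ z, (u z - v z) ∂μ, fun x => ?_⟩
  obtain ⟨ν, hν, h⟩ := hu.exists_isMaximizingMeasure_sub_le hA hv x
  obtain ⟨ν', hν', h'⟩ := hv.exists_isMaximizingMeasure_sub_le hA hu x
  obtain rfl := huniq ν hν
  obtain rfl := huniq ν' hν'
  have hneg : ∫ z, (v z - u z) ∂ν' = -∫ z, (u z - v z) ∂ν' := by
    rw [← integral_neg]
    simp
  linarith
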